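/- Let $R$ be a commutative ring and let $H$ be a Hopf algebra over $R$, with comultiplication $\Delta(h)=\sum h_1\otimes h_2$ and counit $\varepsilon$, such that $H$ is flat as an $R$-module. Let $A$ be a commutative left $H$-module algebra, i.e. a commutative $R$-algebra (associative, with unit) with a left $H$-module structure compatible with its $R$-module structure such that $h\cdot(ab)=\sum (h_1\cdot a)(h_2\cdot b)$ and $h\cdot 1_A=\varepsilon(h)1_A$ for all $h\in H$, $a,b\in A$. Call a ring semiprime if it contains no nonzero nilpotent two-sided ideal (equivalently, no nonzero two-sided ideal with square zero), and assume that $A$ is semiprime. Assume that there is an element $0\neq t\in H$ which is a left integral ($ht=\varepsilon(h)t$ for all $h\in H$) or a right integral ($th=\varepsilon(h)t$ for all $h\in H$) such that $\varepsilon(t)1_A$ is not a zero divisor in $A$. Assume finally that $A$ is integral over its subring of invariants $A^H=\{a\in A : h\cdot a=\varepsilon(h)a \text{ for all } h\in H\}$. Then the smash product $A\# H$, i.e. the $R$-module $A\otimes_R H$ with the multiplication $(a\# h)(b\# g)=\sum a(h_1\cdot b)\# h_2g$, is a semiprime ring. -/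

import Mathlib

open scoped TensorProduct

/-- A ring is semiprime if it has no nonzero two-sided ideal `I` with `I² = 0`
(equivalently, no nonzero nilpotent two-sided ideal). -/
def IsSemiprimeRing (S : Type*) [Ring S] : Prop :=
  ∀ I : TwoSidedIdeal S, (∀ x ∈ I, ∀ y ∈ I, x * y = 0) → I = ⊥

/-- `t` is a left integral of `H`: `h t = ε(h) t` for all `h`. -/
def IsLeftIntegral (R : Type*) {H : Type*} [CommRing R] [Ring H] [HopfAlgebra R H] (t : H) :
    Prop :=
  ∀ h : H, h * t = Coalgebra.counit (R := R) h • t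

/-- `t` is a right integral of `H`: `t h = ε(h) t` for all `h`. -/
def IsRightIntegral (R : Type*) {H : Type*} [CommRing R] [Ring H] [HopfAlgebra R H] (t : H) :
    Prop :=
  ∀ h : H, t * h = Coalgebra.counit (R := R) h • t

/-- The `R`-linear map `H → A`, `h ↦ h • a`. -/
def orbitMap (R H : Type*) {A : Type*} [CommRing R] [Ring H] [Algebra R H]
    [AddCommGroup A] [Module R A] [Module H A] [IsScalarTower R H A] (a : A) : H →ₗ[R] A :=
  (LinearMap.toSpanSingleton H A a).restrictScalars R

/-- An `R`-algebra `A` that is also a left `H`-module (with compatible `R`-module structures) is a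
left `H`-module algebra if `h • (a b) = ∑ (h₁ • a) (h₂ • b)` and `h • 1 = ε(h) 1`. -/
class IsModuleAlgebra (R H A : Type*) [CommRing R] [Ring H] [HopfAlgebra R H]
    [Ring A] [Algebra R A] [Module H A] [IsScalarTower R H A] : Prop where
  smul_mul : ∀ (h : H) (a b : A), h • (a * b) =
    LinearMap.mul' R A
      (TensorProduct.map (orbitMap R H a) (orbitMap R H b) (Coalgebra.comul (R := R) h))
  smul_one : ∀ h : H, h • (1 : A) = algebraMap R A (Coalgebra.counit h)

section

variable (R H A : Type*) [CommRing R] [Ring H] [HopfAlgebra R H]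
  [Ring A] [Algebra R A] [Module H A] [IsScalarTower R H A]

theorem IsModuleAlgebra.smul_mul_repr [IsModuleAlgebra R H A] {ι : Type*} {h : H}
    (r : Coalgebra.Repr R h ι) (a b : A) :
    h • (a * b) = ∑ i ∈ r.index, (r.left i • a) * (r.right i • b) := by
  rw [IsModuleAlgebra.smul_mul (R := R), ← r.eq]
  simp [orbitMap]

/-- The subalgebra `A^H` of `H`-invariant elements: `h • a = ε(h) a` for all `h`. -/
def hopfInvariants [IsModuleAlgebra R H A] : Subalgebra R A where
  carrier := {a | ∀ h : H, h • a = Coalgebra.counit (R := R) h • a}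
  mul_mem' := by
    intro a b ha hb h
    have r := Coalgebra.Repr.arbitrary R h
    rw [IsModuleAlgebra.smul_mul_repr R H A r]
    have hc : Coalgebra.counit (R := R) h
        = ∑ i ∈ r.index, Coalgebra.counit (R := R) (r.left i) *
            Coalgebra.counit (R := R) (r.right i) := by
      conv_lhs => rw [← Coalgebra.sum_counit_smul r]
      simp
    rw [hc, Finset.sum_smul]
    refine Finset.sum_congr rfl fun i _ => ?_
    rw [ha, hb, smul_mul_smul_comm]
  add_mem' := by
    intro a b ha hb h
    rw [smul_add, ha, hb, smul_add]
  algebraMap_mem' := by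
    intro s h
    rw [Algebra.algebraMap_eq_smul_one, smul_comm h s, IsModuleAlgebra.smul_one (R := R),
      Algebra.algebraMap_eq_smul_one, smul_comm]

/-- The underlying module of the smash product `A # H` is `A ⊗[R] H`; an elementary tensor
`a ⊗ₜ h` is the element `a # h`. -/
def SmashProduct (R A H : Type*) [CommRing R] [Ring H] [HopfAlgebra R H]
    [Ring A] [Algebra R A] : Type _ :=
  A ⊗[R] H

namespace SmashProduct

noncomputable instance : AddCommGroup (SmashProduct R A H) :=
  inferInstanceAs (AddCommGroup (A ⊗[R] H))

noncomputable instance : Module R (SmashProduct R A H) :=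
  inferInstanceAs (Module R (A ⊗[R] H))

/-- The element `a # h`. -/
def tmul {R A H : Type*} [CommRing R] [Ring H] [HopfAlgebra R H]
    [Ring A] [Algebra R A] (a : A) (h : H) : SmashProduct R A H :=
  a ⊗ₜ[R] h

/-- The diagonal action of `H` on `A ⊗ H`: `h` acts as `b ⊗ g ↦ ∑ (h₁ • b) ⊗ h₂ g`. -/
noncomputable def diag : H →ₐ[R] Module.End R (A ⊗[R] H) :=
  ((Module.endTensorEndAlgHom (R := R) (S := R) (A := R) (M := A) (N := H)).comp
    (Algebra.TensorProduct.map (Algebra.lsmul R R A) (Algebra.lmul R H))).comp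
      (Bialgebra.comulAlgHom R H)

/-- Left multiplication by `a` on the first factor of `A ⊗ H`. -/
noncomputable def leftMul : A →ₐ[R] Module.End R (A ⊗[R] H) :=
  (Module.endTensorEndAlgHom (R := R) (S := R) (A := R) (M := A) (N := H)).comp
    (Algebra.TensorProduct.includeLeft.comp (Algebra.lmul R A))

/-- The multiplication of `A # H` as a bilinear map: `a # h` acts on `A ⊗ H` as
`b ⊗ g ↦ ∑ a (h₁ • b) ⊗ h₂ g`. -/
noncomputable def mulMap : A ⊗[R] H →ₗ[R] Module.End R (A ⊗[R] H) :=
  TensorProduct.lift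
    ((LinearMap.mul R (Module.End R (A ⊗[R] H))).compl₁₂
      (leftMul R H A).toLinearMap (diag R H A).toLinearMap)

theorem leftMul_tmul (a b : A) (g : H) : leftMul R H A a (b ⊗ₜ g) = (a * b) ⊗ₜ g := by
  simp [leftMul, Module.endTensorEndAlgHom_apply]

theorem diag_tmul {ι : Type*} {h : H} (r : Coalgebra.Repr R h ι) (b : A) (g : H) :
    diag R H A h (b ⊗ₜ g) = ∑ i ∈ r.index, (r.left i • b) ⊗ₜ (r.right i * g) := by
  simp [diag, ← r.eq, Module.endTensorEndAlgHom_apply]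

theorem mulMap_tmul (a : A) (h : H) :
    mulMap R H A (a ⊗ₜ h) = leftMul R H A a * diag R H A h := by
  simp [mulMap]

theorem diag_mul_leftMul [IsModuleAlgebra R H A] {ι : Type*} {h : H}
    (r : Coalgebra.Repr R h ι) (b : A) :
    diag R H A h * leftMul R H A b =
      ∑ i ∈ r.index, leftMul R H A (r.left i • b) * diag R H A (r.right i) := by
  refine TensorProduct.ext' fun c g => ?_
  let r₁ := fun i => Coalgebra.Repr.arbitrary R (r.left i)
  let r₂ := fun i => Coalgebra.Repr.arbitrary R (r.right i)
  have key := congrArg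
    (TensorProduct.lift ((TensorProduct.mk R A H).compl₁₂ (LinearMap.mul' R A)
        (LinearMap.mulRight R g)) ∘ₗ (TensorProduct.map (TensorProduct.map (orbitMap R H b)
        (orbitMap R H c)) LinearMap.id) ∘ₗ (TensorProduct.assoc R H H H).symm.toLinearMap)
    (Coalgebra.sum_tmul_tmul_eq r r₁ r₂)
  simp only [map_sum, LinearMap.comp_apply, LinearEquiv.coe_coe, TensorProduct.assoc_symm_tmul,
    TensorProduct.map_tmul, TensorProduct.lift.tmul, LinearMap.compl₁₂_apply,
    LinearMap.mul'_apply, LinearMap.mulRight_apply, TensorProduct.mk_apply, orbitMap,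
    LinearMap.restrictScalars_apply, LinearMap.toSpanSingleton_apply, LinearMap.id_apply] at key
  rw [Module.End.mul_apply, leftMul_tmul, diag_tmul R H A r, LinearMap.sum_apply]
  simp only [Module.End.mul_apply, diag_tmul R H A (r₂ _), map_sum, leftMul_tmul]
  rw [← key]
  refine Finset.sum_congr rfl fun i _ => ?_
  rw [IsModuleAlgebra.smul_mul_repr R H A (r₁ i), TensorProduct.sum_tmul]

theorem mulMap_mulMap [IsModuleAlgebra R H A] (x y : A ⊗[R] H) :
    mulMap R H A (mulMap R H A x y) = mulMap R H A x * mulMap R H A y := by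
  induction x with
  | zero => simp
  | add x₁ x₂ h₁ h₂ => simp [h₁, h₂, add_mul]
  | tmul a h =>
    induction y with
    | zero => simp
    | add y₁ y₂ h₁ h₂ => simp only [map_add, h₁, h₂, mul_add]
    | tmul b g =>
      have r := Coalgebra.Repr.arbitrary R h
      simp only [mulMap_tmul R H A a h, Module.End.mul_apply, diag_tmul R H A r, map_sum,
        leftMul_tmul, mulMap_tmul, map_mul]
      rw [mul_assoc, ← mul_assoc (diag R H A h), diag_mul_leftMul R H A r, Finset.sum_mul,
        Finset.mul_sum]
      simp only [mul_assoc]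

/-- The smash product ring, with `(a # h) (b # g) = ∑ a (h₁ • b) # h₂ g`
and unit `1 # 1`; see `SmashProduct.tmul_mul_tmul`. -/
noncomputable instance [IsModuleAlgebra R H A] : Ring (SmashProduct R A H) :=
  { (inferInstance : AddCommGroup (SmashProduct R A H)) with
    mul := fun x y => mulMap R H A x y
    one := tmul 1 1
    mul_assoc := fun x y z => LinearMap.congr_fun (mulMap_mulMap R H A x y) z
    one_mul := fun x => by
      change mulMap R H A (1 ⊗ₜ 1) x = x
      rw [mulMap_tmul, map_one, map_one]
      rfl
    mul_one := fun x => by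
      change mulMap R H A x (1 ⊗ₜ 1) = x
      induction x using TensorProduct.induction_on with
      | zero => simp
      | add x₁ x₂ h₁ h₂ =>
        exact (LinearMap.congr_fun (map_add (mulMap R H A) x₁ x₂) _).trans
          (congrArg₂ (· + ·) h₁ h₂)
      | tmul a h =>
        have r := Coalgebra.Repr.arbitrary R h
        rw [mulMap_tmul, Module.End.mul_apply, diag_tmul R H A r, map_sum]
        simp only [leftMul_tmul, IsModuleAlgebra.smul_one (R := R), mul_one,
          Algebra.algebraMap_eq_smul_one, TensorProduct.smul_tmul]
        rw [← TensorProduct.tmul_sum, Coalgebra.sum_counit_smul r]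
    left_distrib := fun x y z => map_add (mulMap R H A x) y z
    right_distrib := fun x y z => LinearMap.congr_fun (map_add (mulMap R H A) x y) z
    zero_mul := fun x => LinearMap.congr_fun (map_zero (mulMap R H A)) x
    mul_zero := fun x => map_zero (mulMap R H A x) }

theorem tmul_mul_tmul [IsModuleAlgebra R H A] {ι : Type*} {h : H}
    (r : Coalgebra.Repr R h ι) (a b : A) (g : H) :
    (tmul a h * tmul b g : SmashProduct R A H) =
      ∑ i ∈ r.index, tmul (a * (r.left i • b)) (r.right i * g) := by
  change mulMap R H A (a ⊗ₜ h) (b ⊗ₜ g) = _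
  rw [mulMap_tmul, Module.End.mul_apply, diag_tmul R H A r, map_sum]
  simp only [leftMul_tmul]
  rfl

noncomputable instance [IsModuleAlgebra R H A] : Algebra R (SmashProduct R A H) :=
  Algebra.ofModule
    (fun s x y => LinearMap.congr_fun (map_smul (mulMap R H A) s x) y)
    (fun s x y => map_smul (mulMap R H A x) s y)

end SmashProduct

end

/-! ### Reduced integral extensions and von Neumann regular rings. -/

section CommutativeAlgebra

open Polynomial

/-! Suppose first that `A` is von Neumann regular, and write `T = A # H`. For a right integral `t`,
the element `∑ S(t₁) ⊗ t₂` of `T ⊗_A T` is Casimir, i.e. commutes with `T` (`SmashProduct.casimir`),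
and its product is `ε(t)`. All `A`-modules are flat, and flatness of `T / xT` turns the Casimir
identity into `ε(t) x ∈ x T x` (`exists_mul_eq_mul_mul_of_casimir`). Hence `x T x = 0` forces `ε(t)
x = 0`, and then `x = 0` because `ε(t)` is regular on `A` and `H` is flat.

In general, `A` is embedded in a von Neumann regular module algebra `A'` generated over `A` by
invariants. These are central in `A' # H`, so `x T x = 0` implies `x (A' # H) x = 0` and the
previous argument applies. To build `A'`, let `B = A^H` and let `p` run over the minimal primes of
`B`. The product `V` of the fields `B_p` is von Neumann regular, and so is the `V`-span of `A` in `∏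
A_p`, being reduced and integral over `V`.

The delicate point is that `A → ∏ A_p` is injective. It rests on `exists_invariant_mem_of_stable`: a
left integral applied to a local unit inside a nonzero stable ideal yields a nonzero invariant of
that ideal. The antipode supplies whichever kind of integral is not given. -/

theorem Polynomial.aeval_eq_coeff_zero_smul_add {B A : Type*} [CommRing B] [CommRing A]
    [Algebra B A] (p : B[X]) (y : A) :
    aeval y p = algebraMap B A (p.coeff 0) + y * aeval y p.divX := by
  have h := congrArg (aeval y) p.X_mul_divX_add
  rw [map_add, map_mul, aeval_X, aeval_C] at h
  rw [← h, add_comm]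

/-- The scalar `c` is the lowest coefficient of `p` that does not kill `a`. The earlier ones kill
`a`, hence `y`, and reducedness allows a factor `y` to be cancelled from `y² * aeval y p.divX = 0`.
-/
theorem exists_mul_eq_smul_of_mul_aeval_eq_zero {B A : Type*} [CommRing B] [CommRing A]
    [IsReduced A] [Algebra B A] {a y : A} (hy : ∀ b : B, b • a = 0 → b • y = 0) (k : ℕ) :
    ∀ p : B[X], y * aeval y p = 0 → p.coeff k • a ≠ 0 →
      ∃ (c : B) (g : A), c • a ≠ 0 ∧ (g * y) * y = c • y := by
  have step : ∀ p : B[X], y * aeval y p = 0 → p.coeff 0 • a = 0 → y * aeval y p.divX = 0 := by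
    intro p hp h0
    have h1 := hy _ h0
    rw [Algebra.smul_def] at h1
    rw [p.aeval_eq_coeff_zero_smul_add] at hp
    refine pow_eq_zero_iff two_ne_zero |>.1 ?_
    linear_combination (aeval y p.divX) * hp - (aeval y p.divX) * h1
  induction k with
  | zero =>
    intro p hp h0
    refine ⟨p.coeff 0, -aeval y p.divX, h0, ?_⟩
    rw [p.aeval_eq_coeff_zero_smul_add] at hp
    rw [Algebra.smul_def]
    linear_combination -hp
  | succ k ih =>
    intro p hp hk
    by_cases h0 : p.coeff 0 • a = 0
    · exact ih p.divX (step p hp h0) (by rwa [coeff_divX])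
    · refine ⟨p.coeff 0, -aeval y p.divX, h0, ?_⟩
      rw [p.aeval_eq_coeff_zero_smul_add] at hp
      rw [Algebra.smul_def]
      linear_combination -hp

/-- In a reduced integral extension `A` of `B`, finitely many elements `y` killed by the
annihilator in `B` of `a ≠ 0` have a common local unit `f`, up to a scalar `c` with `c a ≠ 0`. -/
theorem exists_common_local_unit {B A : Type*} [CommRing B] [CommRing A] [IsReduced A]
    [Algebra B A] [Algebra.IsIntegral B A] {a : A} (ha : a ≠ 0) (I : Ideal A) (Y : Finset A)
    (hYI : ∀ y ∈ Y, y ∈ I) (hY : ∀ y ∈ Y, ∀ b : B, b • a = 0 → b • y = 0) :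
    ∃ (c : B), ∃ f ∈ I, c • a ≠ 0 ∧ ∀ y ∈ Y, f * y = c • y := by
  classical
  induction Y using Finset.induction_on with
  | empty => exact ⟨1, 0, I.zero_mem, by simpa, by simp⟩
  | insert y Y _ ih =>
    obtain ⟨c₀, f₀, hf₀, hc₀, h₀⟩ := ih (fun z hz => hYI z (by simp [hz]))
      (fun z hz => hY z (by simp [hz]))
    obtain ⟨p, hp, hpy⟩ := Algebra.IsIntegral.isIntegral (R := B) (c₀ • y)
    have hpy' : aeval (c₀ • y) p = 0 := hpy
    obtain ⟨c, g, hc, hg⟩ := exists_mul_eq_smul_of_mul_aeval_eq_zero (B := B) (a := c₀ • a)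
      (y := c₀ • y) (fun b hb => by
        rw [smul_smul] at hb ⊢
        exact hY y (by simp) _ hb) p.natDegree p (by rw [hpy', mul_zero])
        (by rwa [hp.coeff_natDegree, one_smul])
    simp only [Algebra.smul_def] at *
    set C := algebraMap B A
    -- The new `f` is chosen so that scalar minus `f` factors: the first factor kills the new `y` by
    -- `hg`, the second kills the earlier elements.
    refine ⟨c * c₀ * c₀, C c * C c₀ * C c₀ - (C c * C c₀ - C c₀ * (g * (C c₀ * y))) * (C c₀ - f₀),
      ?_, ?_, ?_⟩
    · have hyI := hYI y (by simp)
      have : C c * C c₀ * C c₀ - (C c * C c₀ - C c₀ * (g * (C c₀ * y))) * (C c₀ - f₀) =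
        (C c * C c₀ - C c₀ * (g * (C c₀ * y))) * f₀ + (C c₀ * g * C c₀ * C c₀) * y := by ring
      rw [this]
      exact I.add_mem (I.mul_mem_left _ hf₀) (I.mul_mem_left _ hyI)
    · intro h
      -- If `c c₀² a = 0`, then `(c c₀ a)² = 0`, against reducedness.
      apply hc
      refine pow_eq_zero_iff two_ne_zero |>.1 ?_
      simp only [map_mul] at h
      linear_combination (C c * a) * h
    · intro z hz
      simp only [map_mul]
      rcases Finset.mem_insert.1 hz with rfl | hz
      · linear_combination (C c₀ - f₀) * hg
      · linear_combination (C c * C c₀ - C c₀ * (g * (C c₀ * y))) * h₀ z hz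

/-- A commutative ring is von Neumann regular if every `y` is of the form `y² q`. -/
def IsVonNeumannRegular (V : Type*) [CommRing V] : Prop :=
  ∀ y : V, ∃ q : V, y = y ^ 2 * q

/-- Write `p₀ = p₀² w` and split by the idempotent `p₀ w`. On its part, the relation expresses `p₀ w
y` through `y²`. On the complement `p₀` vanishes, and reducedness lowers the degree of the relation.
-/
theorem IsVonNeumannRegular.exists_coeff_smul_eq {V P : Type*} [CommRing V] [CommRing P]
    [IsReduced P] [Algebra V P] (hV : IsVonNeumannRegular V) (y : P) (k : ℕ) :
    ∀ p : V[X], y * aeval y p = 0 → ∃ q : V[X], p.coeff k • y = y ^ 2 * aeval y q := by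
  induction k with
  | zero =>
    intro p hp
    refine ⟨-p.divX, ?_⟩
    rw [p.aeval_eq_coeff_zero_smul_add] at hp
    rw [Algebra.smul_def, map_neg]
    linear_combination hp
  | succ k ih =>
    intro p hp
    obtain ⟨w, hw⟩ := hV (p.coeff 0)
    rw [p.aeval_eq_coeff_zero_smul_add] at hp
    have hw' := congrArg (algebraMap V P) hw
    simp only [map_mul, map_pow] at hw'
    obtain ⟨q, hq⟩ := ih (C (1 - p.coeff 0 * w) * p.divX) (by
      refine pow_eq_zero_iff two_ne_zero |>.1 ?_
      simp only [map_mul, map_sub, map_one, aeval_C]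
      linear_combination (1 - algebraMap V P (p.coeff 0) * algebraMap V P w) ^ 2 *
        (aeval y p.divX) * hp - (1 - algebraMap V P (p.coeff 0) * algebraMap V P w) *
        (aeval y p.divX) * y * hw')
    rw [coeff_C_mul, coeff_divX, Algebra.smul_def] at hq
    simp only [map_mul, map_sub, map_one] at hq
    refine ⟨q - C (p.coeff (k + 1) * w) * p.divX, ?_⟩
    simp only [map_mul, map_sub, aeval_C, Algebra.smul_def]
    linear_combination hq + algebraMap V P (p.coeff (k + 1)) * algebraMap V P w * hp

theorem IsVonNeumannRegular.exists_eq_sq_mul_aeval {V P : Type*} [CommRing V] [CommRing P]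
    [IsReduced P] [Algebra V P] (hV : IsVonNeumannRegular V) {y : P} (hy : IsIntegral V y) :
    ∃ q : V[X], y = y ^ 2 * aeval y q := by
  obtain ⟨p, hp, hpy⟩ := hy
  obtain ⟨q, hq⟩ := hV.exists_coeff_smul_eq y p.natDegree p
    (by rw [show aeval y p = 0 from hpy, mul_zero])
  exact ⟨q, by rwa [hp.coeff_natDegree, one_smul] at hq⟩

theorem IsVonNeumannRegular.exists_local_unit {V : Type*} [CommRing V]
    (hV : IsVonNeumannRegular V) {ι : Type*} (s : Finset ι) (f : ι → V) :
    ∃ e ∈ Ideal.span (Set.range f), ∀ i ∈ s, e * f i = f i := by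
  classical
  induction s using Finset.induction_on with
  | empty => exact ⟨0, Ideal.zero_mem _, by simp⟩
  | insert j s _ ih =>
    obtain ⟨e, he, h⟩ := ih
    obtain ⟨q, hq⟩ := hV (f j)
    -- One minus this element is `(1 - e) (1 - q f_j)`.
    refine ⟨e + (q - e * q) * f j, Ideal.add_mem _ he
      (Ideal.mul_mem_left _ _ (Ideal.subset_span ⟨j, rfl⟩)), ?_⟩
    intro i hi
    rcases Finset.mem_insert.1 hi with rfl | hi
    · linear_combination (e - 1) * hq
    · linear_combination (1 - q * f j) * h i hi

/-- By the equational criterion: if `e = ∑ gᵢ fᵢ` is a local unit for the coefficients of a relation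
`∑ fᵢ xᵢ = 0`, the matrix `δᵢⱼ - gᵢ fⱼ` fixes the vector `x` and is killed by the row `f`. -/
theorem IsVonNeumannRegular.flat {V : Type*} [CommRing V] (hV : IsVonNeumannRegular V)
    (M : Type*) [AddCommGroup M] [Module V M] : Module.Flat V M := by
  classical
  refine Module.Flat.of_forall_isTrivialRelation fun {l f x} hfx => ?_
  obtain ⟨e, he, h⟩ := hV.exists_local_unit Finset.univ f
  obtain ⟨g, hg⟩ := Ideal.mem_span_range_iff_exists_fun.1 he
  refine ⟨l, fun i j => (if i = j then 1 else 0) - g i * f j, x, ?_, ?_⟩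
  · intro i
    simp [sub_smul, Finset.sum_sub_distrib, mul_smul, ← Finset.smul_sum, hfx]
  · intro j
    have hj := h j (Finset.mem_univ _)
    rw [← hg, Finset.sum_mul] at hj
    simp only [mul_sub, Finset.sum_sub_distrib, mul_ite, mul_one, mul_zero,
      Finset.sum_ite_eq', Finset.mem_univ, if_true]
    rw [sub_eq_zero]
    exact hj.symm.trans (Finset.sum_congr rfl fun i _ => by ring)

end CommutativeAlgebra

/-! ### Casimir elements over a von Neumann regular ring. -/

section Casimir

open MulOpposite

universe u

/-- A copy of a ring `S`, to be regarded as a right module over its subrings. -/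
def RightRegular (S : Type u) : Type u := Sᵐᵒᵖ

instance (S : Type u) [Ring S] : Ring (RightRegular S) := inferInstanceAs (Ring Sᵐᵒᵖ)

/-- The canonical additive bijection from a ring to its copy. -/
def RightRegular.of {S : Type u} [Ring S] : S ≃+ RightRegular S := opAddEquiv

open RightRegular in
/-- If `∑ uₖ ⊗ vₖ ∈ S ⊗_V S` is a Casimir element of a ring `S` over a von Neumann regular
commutative ring `V`, then `(∑ uₖ vₖ) x ∈ x S x` for all `x`. -/
theorem exists_mul_eq_mul_mul_of_casimir {V ι : Type*} {S : Type u} [CommRing V] [Ring S]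
    (hV : IsVonNeumannRegular V) (i : V →+* S) (s : Finset ι) (u v : ι → S)
    (hC : ∀ (Q : Type u) [AddCommGroup Q] (β : S →+ S →+ Q),
      (∀ a p q, β (p * i a) q = β p (i a * q)) →
      ∀ x, ∑ k ∈ s, β (x * u k) (v k) = ∑ k ∈ s, β (u k) (v k * x)) (x : S) :
    ∃ y, (∑ k ∈ s, u k * v k) * x = x * y * x := by
  -- The image of `V` need not be central in `S`, so the left factor of `S ⊗_V S` carries right
  -- multiplication by `V`.
  let iop : V →+* RightRegular S := (i.toOpposite fun a b => by
    rw [Commute, SemiconjBy, ← map_mul, ← map_mul, mul_comm])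
  let _ : Module V (RightRegular S) := Module.compHom (RightRegular S) iop
  let _ : Module V S := Module.compHom S i
  have smul_op : ∀ (a : V) (p : S), a • of p = of (p * i a) := fun a p => rfl
  have smul_eq : ∀ (a : V) (p : S), a • p = i a * p := fun a p => rfl
  let N : Submodule V S :=
    { carrier := {n | ∃ y, n = y * x}
      add_mem' := by
        rintro _ _ ⟨y, rfl⟩ ⟨z, rfl⟩
        exact ⟨y + z, by rw [add_mul]⟩
      zero_mem' := ⟨0, by simp⟩
      smul_mem' := by
        rintro a _ ⟨y, rfl⟩
        exact ⟨i a * y, by rw [smul_eq, mul_assoc]⟩ }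
  let L : Submodule V (RightRegular S) :=
    { carrier := {n | ∃ y, n = of (x * y)}
      add_mem' := by
        rintro _ _ ⟨y, rfl⟩ ⟨z, rfl⟩
        exact ⟨y + z, by rw [mul_add, map_add]⟩
      zero_mem' := ⟨0, by simp⟩
      smul_mem' := by
        rintro a _ ⟨y, rfl⟩
        exact ⟨y * i a, by rw [smul_op, mul_assoc]⟩ }
  let β : S →+ S →+ ((RightRegular S) ⊗[V] S) :=
    { toFun := fun p => (TensorProduct.mk V (RightRegular S) S (of p)).toAddMonoidHom
      map_zero' := by ext; simp
      map_add' := by intro p q; ext; simp }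
  have hβ : ∀ p q, β p q = of p ⊗ₜ q := fun p q => rfl
  have hcas := hC _ β (fun a p q => by
    rw [hβ, hβ, ← smul_op, ← smul_eq, TensorProduct.smul_tmul]) x
  simp only [hβ] at hcas
  let z : (RightRegular S) ⊗[V] N := ∑ k ∈ s, of (u k) ⊗ₜ ⟨v k * x, v k, rfl⟩
  -- Flatness of `S / xS` allows vanishing to be tested in `(S / xS) ⊗ S`, where the Casimir
  -- identity rewrites the image of `z` as `∑ x uₖ ⊗ vₖ = 0`.
  have hz : L.mkQ.rTensor N z = 0 := by
    have := hV.flat ((RightRegular S) ⧸ L)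
    apply Module.Flat.lTensor_preserves_injective_linearMap (M := (RightRegular S) ⧸ L) N.subtype
      N.subtype_injective
    rw [map_zero]
    simp only [z, map_sum, LinearMap.rTensor_tmul, LinearMap.lTensor_tmul, Submodule.subtype_apply]
    have h := congrArg (L.mkQ.rTensor S) hcas
    simp only [map_sum, LinearMap.rTensor_tmul] at h
    rw [← h]
    refine Finset.sum_eq_zero fun k _ => ?_
    rw [show L.mkQ (of (x * u k)) = 0 from
      (Submodule.Quotient.mk_eq_zero L).2 ⟨u k, rfl⟩, TensorProduct.zero_tmul]
  -- Right exactness lifts `z` to `xS ⊗ Sx`, which multiplication maps into `x S x`.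
  have hex : Function.Exact (L.subtype.rTensor N) (L.mkQ.rTensor N) :=
    rTensor_exact N (LinearMap.exact_subtype_mkQ L) L.mkQ_surjective
  obtain ⟨w, hw⟩ := (hex z).1 hz
  let m : (RightRegular S) ⊗[V] N →+ S := TensorProduct.liftAddHom
    { toFun := fun p => (AddMonoidHom.mulLeft (of.symm p)).comp N.subtype.toAddMonoidHom
      map_zero' := by ext; simp
      map_add' := by intro p q; ext; simp [add_mul] }
    (by
      intro a p q
      change (of.symm p * i a) * (q : S) = of.symm p * (i a * (q : S))
      rw [mul_assoc])
  have hm : ∀ (p : (RightRegular S)) (q : N), m (p ⊗ₜ q) = of.symm p * q := fun p q => rfl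
  have hmw : ∀ w, ∃ y, m (L.subtype.rTensor N w) = x * y * x := by
    intro w
    induction w with
    | zero => exact ⟨0, by simp⟩
    | add w₁ w₂ h₁ h₂ =>
      obtain ⟨y₁, h₁⟩ := h₁
      obtain ⟨y₂, h₂⟩ := h₂
      exact ⟨y₁ + y₂, by rw [map_add, map_add, h₁, h₂, mul_add, add_mul]⟩
    | tmul p q =>
      obtain ⟨p, y, rfl⟩ := p
      obtain ⟨q, y', rfl⟩ := q
      exact ⟨y * y', by rw [LinearMap.rTensor_tmul, hm]; simp [mul_assoc]⟩
  obtain ⟨y, hy⟩ := hmw w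
  refine ⟨y, ?_⟩
  rw [← hy, hw, map_sum, Finset.sum_mul]
  exact Finset.sum_congr rfl fun k _ => by rw [hm, AddEquiv.symm_apply_apply, mul_assoc]

end Casimir

/-! ### Integrals and the antipode. -/

section Integrals

variable {R H : Type*} [CommRing R] [Ring H] [HopfAlgebra R H]

open Coalgebra HopfAlgebra

theorem sum_counit_right_smul {ι : Type*} {h : H} (r : Coalgebra.Repr R h ι) :
    ∑ k ∈ r.index, counit (R := R) (r.right k) • r.left k = h := by
  have := congrArg (TensorProduct.rid R H) (sum_tmul_counit_eq r)
  simpa only [map_sum, TensorProduct.rid_tmul, one_smul] using this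

/-- `S(t) h = ∑ S(ε(h₁) t) h₂ = ∑ S(h₁ t) h₂ = S(t) ∑ S(h₁) h₂ = ε(h) S(t)`. -/
theorem IsLeftIntegral.isRightIntegral_antipode {t : H} (ht : IsLeftIntegral R t) :
    IsRightIntegral R (antipode R t) := by
  intro h
  have r := Coalgebra.Repr.arbitrary R h
  conv_lhs => rw [← sum_counit_smul r]
  have : ∀ k, antipode R t * (counit (R := R) (r.left k) • r.right k) =
      antipode R t * (antipode R (r.left k) * r.right k) := fun k => by
    rw [mul_smul_comm, ← smul_mul_assoc, ← map_smul, ← ht, antipode_mul_antidistrib, mul_assoc]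
  simp_rw [Finset.mul_sum, this]
  rw [← Finset.mul_sum, sum_antipode_mul_eq_smul r, mul_smul_comm, mul_one]

theorem IsRightIntegral.isLeftIntegral_antipode {t : H} (ht : IsRightIntegral R t) :
    IsLeftIntegral R (antipode R t) := by
  intro h
  have r := Coalgebra.Repr.arbitrary R h
  conv_lhs => rw [← sum_counit_right_smul r]
  have : ∀ k, (counit (R := R) (r.right k) • r.left k) * antipode R t =
      r.left k * antipode R (r.right k) * antipode R t := fun k => by
    rw [smul_mul_assoc, ← mul_smul_comm, ← map_smul, ← ht, antipode_mul_antidistrib, mul_assoc]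
  simp_rw [Finset.sum_mul, this]
  rw [← Finset.sum_mul, sum_mul_antipode_eq_smul r, smul_mul_assoc, one_mul]

/-- The map `g ↦ ∑ S(g₁) ⊗ g₂`. -/
noncomputable def antipodeTensor (R H : Type*) [CommRing R] [Ring H] [HopfAlgebra R H] :
    H →ₗ[R] H ⊗[R] H :=
  (antipode R).rTensor H ∘ₗ comul

theorem antipodeTensor_mul {ι : Type*} (t : H) {g : H} (r : Coalgebra.Repr R g ι) :
    antipodeTensor R H (t * g) = ∑ k ∈ r.index,
      TensorProduct.map (LinearMap.mulLeft R (antipode R (r.left k)))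
        (LinearMap.mulRight R (r.right k)) (antipodeTensor R H t) := by
  have q := Coalgebra.Repr.arbitrary R t
  simp only [antipodeTensor, LinearMap.comp_apply, Bialgebra.comul_mul]
  rw [← r.eq, ← q.eq]
  simp only [Finset.sum_mul_sum, map_sum, Algebra.TensorProduct.tmul_mul_tmul,
    LinearMap.rTensor_tmul, TensorProduct.map_tmul, LinearMap.mulLeft_apply,
    LinearMap.mulRight_apply, antipode_mul_antidistrib]
  exact Finset.sum_comm

/-- Inserting `ε(h₂) t = t h₂` gives `∑ h S(t₁) ⊗ t₂ = ∑ h₁ S(h₂) S(t₁) ⊗ t₂ h₃`, and `∑ h₁ S(h₂) ⊗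
h₃` collapses to `1 ⊗ h`. -/
theorem IsRightIntegral.casimir {t : H} (ht : IsRightIntegral R t) (h : H) :
    (LinearMap.mulLeft R h).rTensor H (antipodeTensor R H t) =
      (LinearMap.mulRight R h).lTensor H (antipodeTensor R H t) := by
  have r := Coalgebra.Repr.arbitrary R h
  let r₁ := fun i => Coalgebra.Repr.arbitrary R (r.left i)
  let r₂ := fun i => Coalgebra.Repr.arbitrary R (r.right i)
  have h₁ : (LinearMap.mulLeft R h).rTensor H (antipodeTensor R H t) =
      ∑ k ∈ r.index, ∑ l ∈ (r₂ k).index, (LinearMap.mulLeft R (r.left k)).rTensor H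
        (TensorProduct.map (LinearMap.mulLeft R (antipode R ((r₂ k).left l)))
        (LinearMap.mulRight R ((r₂ k).right l)) (antipodeTensor R H t)) := by
    simp_rw [← map_sum, ← antipodeTensor_mul, ht _, map_smul]
    conv_lhs => rw [← sum_counit_right_smul r]
    generalize antipodeTensor R H t = z
    induction z with
    | zero => simp
    | add x y hx hy => simp only [map_add, hx, hy, smul_add, Finset.sum_add_distrib]
    | tmul x y =>
      simp [Finset.sum_mul, TensorProduct.sum_tmul, TensorProduct.smul_tmul']
  rw [h₁]
  generalize antipodeTensor R H t = z
  induction z with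
  | zero => simp
  | add x y hx hy => simp only [map_add, hx, hy, Finset.sum_add_distrib]
  | tmul x y =>
    have key := congrArg (TensorProduct.map (LinearMap.mulRight R x ∘ₗ LinearMap.mul' R H ∘ₗ
      (antipode R).lTensor H) (LinearMap.mulLeft R y) ∘ₗ
      (TensorProduct.assoc R H H H).symm.toLinearMap) (sum_tmul_tmul_eq r r₁ r₂)
    simp only [map_sum, LinearMap.comp_apply, LinearEquiv.coe_coe, TensorProduct.assoc_symm_tmul,
      TensorProduct.map_tmul, LinearMap.lTensor_tmul, LinearMap.mul'_apply,
      LinearMap.mulRight_apply, LinearMap.mulLeft_apply] at key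
    simp only [TensorProduct.map_tmul, LinearMap.rTensor_tmul, LinearMap.lTensor_tmul,
      LinearMap.mulRight_apply, LinearMap.mulLeft_apply, ← mul_assoc]
    rw [← key]
    simp only [← TensorProduct.sum_tmul, ← Finset.sum_mul, sum_mul_antipode_eq_smul]
    conv_rhs => rw [← sum_counit_smul r]
    simp [Finset.mul_sum, TensorProduct.tmul_sum, TensorProduct.smul_tmul]

end Integrals

/-! ### Invariants in stable ideals. -/

section HopfModuleAlgebra

open Coalgebra HopfAlgebra

variable {R H A : Type*} [CommRing R] [Ring H] [HopfAlgebra R H]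
  [CommRing A] [Algebra R A] [Module H A] [IsScalarTower R H A] [IsModuleAlgebra R H A]

theorem smul_invariant_mul (b : hopfInvariants R H A) (h : H) (a : A) :
    h • ((b : A) * a) = b * (h • a) := by
  have r := Coalgebra.Repr.arbitrary R h
  rw [IsModuleAlgebra.smul_mul_repr R H A r]
  conv_rhs => rw [← sum_counit_smul r, Finset.sum_smul, Finset.mul_sum]
  refine Finset.sum_congr rfl fun k _ => ?_
  rw [b.2, smul_mul_assoc, smul_assoc, mul_smul_comm (counit (R := R) (r.left k))]

/-- Expanding gives `∑ (t₁ • f) (t₂ S(t₃) • a)`, where the antipode cancels. It is used to compare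
`t • f` with `t • c` when `f` acts as a scalar `c` on all the `S(t₂) • a`. -/
theorem sum_smul_mul_antipode_smul {ι : Type*} {t : H} (r : Coalgebra.Repr R t ι) (f a : A) :
    ∑ k ∈ r.index, r.left k • (f * (antipode R (r.right k) • a)) = (t • f) * a := by
  let r₁ := fun i => Coalgebra.Repr.arbitrary R (r.left i)
  let r₂ := fun i => Coalgebra.Repr.arbitrary R (r.right i)
  have key := congrArg (LinearMap.mul' R A ∘ₗ TensorProduct.map (orbitMap R H f)
    (orbitMap R H a ∘ₗ LinearMap.mul' R H ∘ₗ (antipode R).lTensor H)) (sum_tmul_tmul_eq r r₁ r₂)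
  simp only [map_sum, LinearMap.comp_apply, TensorProduct.map_tmul, LinearMap.lTensor_tmul,
    LinearMap.mul'_apply, orbitMap, LinearMap.restrictScalars_apply,
    LinearMap.toSpanSingleton_apply] at key
  simp only [IsModuleAlgebra.smul_mul_repr R H A (r₁ _), ← mul_smul]
  rw [key]
  simp only [← Finset.mul_sum, ← Finset.sum_smul, sum_mul_antipode_eq_smul]
  conv_rhs => rw [← sum_counit_right_smul r]
  simp [Finset.sum_smul, Finset.sum_mul]

/-- A nonzero stable ideal of a reduced module algebra that is integral over its invariants
contains a nonzero invariant. -/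
theorem exists_invariant_mem_of_stable [IsReduced A]
    [Algebra.IsIntegral (hopfInvariants R H A) A] {t : H} (ht : IsLeftIntegral R t)
    (hreg : algebraMap R A (counit t) ∈ nonZeroDivisors A) (I : Ideal A)
    (hI : ∀ (h : H), ∀ a ∈ I, h • a ∈ I) {a : A} (haI : a ∈ I) (ha : a ≠ 0) :
    ∃ b : hopfInvariants R H A, (b : A) ∈ I ∧ b ≠ 0 := by
  classical
  have r := Coalgebra.Repr.arbitrary R t
  -- The action commutes with invariants, so whatever kills `a` kills every `S(t₂) • a`.
  obtain ⟨c, f, hf, hc, hcf⟩ := exists_common_local_unit (B := hopfInvariants R H A) ha I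
    (r.index.image fun k => antipode R (r.right k) • a)
    (by
      simp only [Finset.mem_image]
      rintro _ ⟨k, _, rfl⟩
      exact hI _ _ haI)
    (by
      simp only [Finset.mem_image]
      rintro _ ⟨k, _, rfl⟩ b hb
      rw [Algebra.smul_def] at hb ⊢
      exact (smul_invariant_mul b _ a).symm.trans ((congrArg _ hb).trans (smul_zero _)))
  have key := sum_smul_mul_antipode_smul r f a
  have h₁ : ∑ k ∈ r.index, r.left k • (f * (antipode R (r.right k) • a)) =
      algebraMap R A (counit t) * (c • a) := by
    calc _ = ∑ k ∈ r.index, r.left k • ((c : A) * (antipode R (r.right k) • a)) :=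
          Finset.sum_congr rfl fun k hk => by
            rw [hcf _ (Finset.mem_image_of_mem _ hk)]; rfl
      _ = (t • (c : A)) * a := sum_smul_mul_antipode_smul r (c : A) a
      _ = _ := by
        rw [c.2, Algebra.smul_def, mul_assoc]; rfl
  -- `t • f` is invariant because `t` is a left integral, and nonzero because `(t • f) a = ε(t) c
  -- a`.
  refine ⟨⟨t • f, fun h => ?_⟩, hI _ _ hf, fun h0 => hc ?_⟩
  · rw [← mul_smul, ht, smul_assoc]
  · have h0' : t • f = 0 := congrArg Subtype.val h0
    rw [h0', zero_mul, h₁] at key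
    exact (mul_left_mem_nonZeroDivisors_eq_zero_iff hreg).1 key

end HopfModuleAlgebra

/-! ### The Casimir element of the smash product. -/

namespace SmashProduct

open Coalgebra HopfAlgebra WithConv

section Ring

variable {R H A : Type*} [CommRing R] [Ring H] [HopfAlgebra R H]
  [Ring A] [Algebra R A] [Module H A] [IsScalarTower R H A] [IsModuleAlgebra R H A]

theorem induction_on {motive : SmashProduct R A H → Prop} (x : SmashProduct R A H)
    (zero : motive 0) (tmul : ∀ a h, motive (tmul a h))
    (add : ∀ x y, motive x → motive y → motive (x + y)) : motive x :=
  TensorProduct.induction_on (motive := motive) x zero tmul add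

theorem add_tmul (a b : A) (h : H) :
    (tmul (a + b) h : SmashProduct R A H) = tmul a h + tmul b h :=
  TensorProduct.add_tmul a b h

theorem tmul_add (a : A) (h g : H) :
    (tmul a (h + g) : SmashProduct R A H) = tmul a h + tmul a g :=
  TensorProduct.tmul_add a h g

theorem smul_tmul' (s : R) (a : A) (h : H) :
    (s • tmul a h : SmashProduct R A H) = tmul (s • a) h :=
  TensorProduct.smul_tmul' s a h

theorem tmul_smul (s : R) (a : A) (h : H) :
    (tmul a (s • h) : SmashProduct R A H) = s • tmul a h :=
  TensorProduct.tmul_smul s a h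

theorem tmul_one_mul_tmul (a b : A) (g : H) :
    (tmul a 1 * tmul b g : SmashProduct R A H) = tmul (a * b) g := by
  change mulMap R H A (a ⊗ₜ 1) (b ⊗ₜ g) = _
  rw [mulMap_tmul, map_one, mul_one, leftMul_tmul]
  rfl

theorem tmul_mul_one_tmul (a : A) (h g : H) :
    (tmul a h * tmul 1 g : SmashProduct R A H) = tmul a (h * g) := by
  have r := Coalgebra.Repr.arbitrary R h
  rw [tmul_mul_tmul R H A r]
  conv_rhs => rw [← sum_counit_smul r, Finset.sum_mul]
  simp only [IsModuleAlgebra.smul_one (R := R), Algebra.algebraMap_eq_smul_one, mul_smul_comm,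
    mul_one, ← smul_tmul', smul_mul_assoc, ← tmul_smul]
  exact (TensorProduct.tmul_sum a r.index _).symm

variable (R H A) in
/-- The inclusion of `A` in `A # H`. -/
noncomputable def inclLeft : A →ₐ[R] SmashProduct R A H :=
  AlgHom.ofLinearMap
    { toFun := fun a => tmul a 1
      map_add' := fun a b => add_tmul a b 1
      map_smul' := fun s a => (smul_tmul' s a 1).symm } rfl
    (fun a b => (tmul_one_mul_tmul a b 1).symm)

variable (R H A) in
/-- The inclusion of `H` in `A # H`. -/
noncomputable def inclRight : H →ₐ[R] SmashProduct R A H :=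
  AlgHom.ofLinearMap
    { toFun := fun h => tmul 1 h
      map_add' := fun a b => tmul_add 1 a b
      map_smul' := fun s a => tmul_smul s 1 a } rfl
    (fun a b => (tmul_mul_one_tmul 1 a b).symm)

theorem inclLeft_apply (a : A) : inclLeft R H A a = tmul a 1 := rfl

theorem inclRight_apply (h : H) : inclRight R H A h = tmul 1 h := rfl

theorem inclLeft_mul_inclRight (a : A) (h : H) :
    inclLeft R H A a * inclRight R H A h = tmul a h := by
  rw [inclLeft_apply, inclRight_apply, tmul_mul_one_tmul, one_mul]

theorem inclRight_mul_inclLeft {ι : Type*} {h : H} (r : Coalgebra.Repr R h ι) (a : A) :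
    inclRight R H A h * inclLeft R H A a =
      ∑ k ∈ r.index, inclLeft R H A (r.left k • a) * inclRight R H A (r.right k) := by
  simp_rw [inclLeft_mul_inclRight]
  rw [inclLeft_apply, inclRight_apply, tmul_mul_tmul R H A r]
  simp only [one_mul, mul_one]

/-- A convolution computation in `Hom(H, A # H)`: `F * J = G` encodes `∑ (h₁ • a) h₂ = h a`. Since
`J'` is inverse to `J`, `J' * F = (J' * G) * J'`, and `J' * G` is `h ↦ ε(h) a`. -/
theorem sum_antipode_mul_smul {ι : Type*} {h : H} (r : Coalgebra.Repr R h ι) (a : A) :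
    ∑ k ∈ r.index, inclRight R H A (antipode R (r.left k)) * inclLeft R H A (r.right k • a) =
      inclLeft R H A a * inclRight R H A (antipode R h) := by
  let J : WithConv (H →ₗ[R] SmashProduct R A H) := toConv (inclRight R H A).toLinearMap
  let J' : WithConv (H →ₗ[R] SmashProduct R A H) :=
    toConv ((inclRight R H A).toLinearMap ∘ₗ antipode R)
  let F : WithConv (H →ₗ[R] SmashProduct R A H) :=
    toConv ((inclLeft R H A).toLinearMap ∘ₗ orbitMap R H a)
  let G : WithConv (H →ₗ[R] SmashProduct R A H) :=
    toConv (LinearMap.mulRight R (inclLeft R H A a) ∘ₗ (inclRight R H A).toLinearMap)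
  have hJ : ∀ h, J h = inclRight R H A h := fun h => rfl
  have hJ' : ∀ h, J' h = inclRight R H A (antipode R h) := fun h => rfl
  have hF : ∀ h, F h = inclLeft R H A (h • a) := fun h => rfl
  have hG : ∀ h, G h = inclRight R H A h * inclLeft R H A a := fun h => rfl
  have hFJ : F * J = G := by
    ext h
    have r := Coalgebra.Repr.arbitrary R h
    rw [r.convMul_apply, hG, inclRight_mul_inclLeft r]
    simp only [hF, hJ]
  have hJJ' : J * J' = 1 := by
    ext h
    have r := Coalgebra.Repr.arbitrary R h
    rw [r.convMul_apply, LinearMap.convOne_apply]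
    simp only [hJ, hJ', ← map_mul, ← map_sum]
    rw [sum_mul_antipode_eq_algebraMap_counit, AlgHom.commutes]
  have hJG : ∀ h, (J' * G) h = counit (R := R) h • inclLeft R H A a := by
    intro h
    have r := Coalgebra.Repr.arbitrary R h
    rw [r.convMul_apply]
    simp only [hG, hJ', ← mul_assoc, ← map_mul, ← Finset.sum_mul, ← map_sum]
    rw [sum_antipode_mul_eq_smul, map_smul, map_one, smul_mul_assoc, one_mul]
  have hmain : J' * F = (J' * G) * J' := by
    rw [← hFJ, mul_assoc, mul_assoc, hJJ', mul_one]
  have := congrArg (fun T => T h) hmain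
  simp only [r.convMul_apply] at this
  simp only [hJ', hF, hJG] at this
  rw [this]
  conv_rhs => rw [← sum_counit_smul r]
  simp only [map_sum, map_smul, Finset.mul_sum, mul_smul_comm, smul_mul_assoc]

end Ring

section Casimir

variable {R H A : Type*} [CommRing R] [Ring H] [HopfAlgebra R H]
  [CommRing A] [Algebra R A] [Module H A] [IsScalarTower R H A] [IsModuleAlgebra R H A]

/-- The additive map on `S ⊗ S` induced by a biadditive map on `S = A # H` balanced over `A`. -/
noncomputable def liftBalanced {Q : Type*} [AddCommGroup Q]
    (β : SmashProduct R A H →+ SmashProduct R A H →+ Q)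
    (hβ : ∀ a p q, β (p * inclLeft R H A a) q = β p (inclLeft R H A a * q)) :
    SmashProduct R A H ⊗[R] SmashProduct R A H →+ Q :=
  TensorProduct.liftAddHom β fun s p q => by
    have := hβ (algebraMap R A s) p q
    rwa [AlgHom.commutes, ← Algebra.commutes, ← Algebra.smul_def, ← Algebra.smul_def] at this

theorem liftBalanced_tmul {Q : Type*} [AddCommGroup Q]
    (β : SmashProduct R A H →+ SmashProduct R A H →+ Q)
    (hβ : ∀ a p q, β (p * inclLeft R H A a) q = β p (inclLeft R H A a * q))
    (p q : SmashProduct R A H) : liftBalanced β hβ (p ⊗ₜ q) = β p q := rfl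

theorem casimir_inclRight {ι Q : Type*} [AddCommGroup Q] {t : H} (ht : IsRightIntegral R t)
    (r : Coalgebra.Repr R t ι) (β : SmashProduct R A H →+ SmashProduct R A H →+ Q)
    (hβ : ∀ a p q, β (p * inclLeft R H A a) q = β p (inclLeft R H A a * q)) (h : H) :
    ∑ k ∈ r.index, β (inclRight R H A h * inclRight R H A (antipode R (r.left k)))
        (inclRight R H A (r.right k)) =
      ∑ k ∈ r.index, β (inclRight R H A (antipode R (r.left k)))
        (inclRight R H A (r.right k) * inclRight R H A h) := by
  have key := congrArg (fun z => liftBalanced β hβ (TensorProduct.map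
    (inclRight R H A).toLinearMap (inclRight R H A).toLinearMap z)) (ht.casimir h)
  simp only [antipodeTensor, LinearMap.comp_apply] at key
  rw [← r.eq] at key
  simpa only [map_sum, LinearMap.rTensor_tmul, LinearMap.lTensor_tmul, TensorProduct.map_tmul,
    liftBalanced_tmul, LinearMap.mulLeft_apply, LinearMap.mulRight_apply,
    AlgHom.toLinearMap_apply, map_mul] using key

/-- `∑ a S(t₁) ⊗ t₂ = ∑ S(t₁) (t₂ • a) ⊗ t₃ = ∑ S(t₁) ⊗ (t₂ • a) t₃ = ∑ S(t₁) ⊗ t₂ a`, the middle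
equality being balancedness over `A`. -/
theorem casimir_inclLeft {ι Q : Type*} [AddCommGroup Q] {t : H}
    (r : Coalgebra.Repr R t ι) (β : SmashProduct R A H →+ SmashProduct R A H →+ Q)
    (hβ : ∀ a p q, β (p * inclLeft R H A a) q = β p (inclLeft R H A a * q)) (a : A) :
    ∑ k ∈ r.index, β (inclLeft R H A a * inclRight R H A (antipode R (r.left k)))
        (inclRight R H A (r.right k)) =
      ∑ k ∈ r.index, β (inclRight R H A (antipode R (r.left k)))
        (inclRight R H A (r.right k) * inclLeft R H A a) := by
  let r₁ := fun i => Coalgebra.Repr.arbitrary R (r.left i)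
  let r₂ := fun i => Coalgebra.Repr.arbitrary R (r.right i)
  have key := congrArg (fun z => liftBalanced β hβ (TensorProduct.map
    ((inclRight R H A).toLinearMap ∘ₗ antipode R) (LinearMap.mul' R (SmashProduct R A H) ∘ₗ
      TensorProduct.map ((inclLeft R H A).toLinearMap ∘ₗ orbitMap R H a)
        (inclRight R H A).toLinearMap) z)) (sum_tmul_tmul_eq r r₁ r₂)
  simp only [map_sum, TensorProduct.map_tmul, LinearMap.comp_apply, LinearMap.mul'_apply,
    liftBalanced_tmul, AlgHom.toLinearMap_apply, orbitMap, LinearMap.restrictScalars_apply,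
    LinearMap.toSpanSingleton_apply] at key
  simp only [← hβ] at key
  calc _ = ∑ k ∈ r.index, ∑ l ∈ (r₁ k).index,
        β (inclRight R H A (antipode R ((r₁ k).left l)) *
          inclLeft R H A ((r₁ k).right l • a)) (inclRight R H A (r.right k)) := by
        refine Finset.sum_congr rfl fun k _ => ?_
        rw [← sum_antipode_mul_smul (r₁ k), map_sum, AddMonoidHom.finsetSum_apply]
    _ = _ := key
    _ = _ := by
        refine Finset.sum_congr rfl fun k _ => ?_
        rw [inclRight_mul_inclLeft (r₂ k), map_sum]
        exact Finset.sum_congr rfl fun l _ => hβ _ _ _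

theorem casimir {ι Q : Type*} [AddCommGroup Q] {t : H} (ht : IsRightIntegral R t)
    (r : Coalgebra.Repr R t ι) (β : SmashProduct R A H →+ SmashProduct R A H →+ Q)
    (hβ : ∀ a p q, β (p * inclLeft R H A a) q = β p (inclLeft R H A a * q))
    (x : SmashProduct R A H) :
    ∑ k ∈ r.index, β (x * inclRight R H A (antipode R (r.left k))) (inclRight R H A (r.right k)) =
      ∑ k ∈ r.index, β (inclRight R H A (antipode R (r.left k)))
        (inclRight R H A (r.right k) * x) := by
  induction x using induction_on with
  | zero => simp
  | add x y hx hy =>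
    simp only [add_mul, mul_add, map_add, AddMonoidHom.add_apply, Finset.sum_add_distrib, hx, hy]
  | tmul a h =>
    rw [← inclLeft_mul_inclRight]
    -- For `x = a h`, first `h` and then `a` moves across the tensor; the other factor is absorbed
    -- into the biadditive map.
    have h₁ := casimir_inclRight ht r (β.comp (AddMonoidHom.mulLeft (inclLeft R H A a)))
      (fun b p q => by
        simp only [AddMonoidHom.comp_apply, AddMonoidHom.coe_mulLeft, ← mul_assoc, hβ]) h
    have h₂ := casimir_inclLeft r
      (β.flip.comp (AddMonoidHom.mulRight (inclRight R H A h))).flip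
      (fun b p q => by
        simp only [AddMonoidHom.flip_apply, AddMonoidHom.comp_apply,
          AddMonoidHom.mulRight_apply, mul_assoc, hβ]) a
    simp only [AddMonoidHom.flip_apply, AddMonoidHom.comp_apply, AddMonoidHom.coe_mulLeft,
      AddMonoidHom.mulRight_apply] at h₁ h₂
    simp only [← mul_assoc] at h₁ h₂ ⊢
    rw [h₁, h₂]

theorem exists_counit_smul_eq_mul_mul (hA : IsVonNeumannRegular A) {t : H}
    (ht : IsRightIntegral R t) (x : SmashProduct R A H) :
    ∃ y, counit (R := R) t • x = x * y * x := by
  have r := Coalgebra.Repr.arbitrary R t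
  obtain ⟨y, hy⟩ := exists_mul_eq_mul_mul_of_casimir hA (inclLeft R H A).toRingHom r.index
    (fun k => inclRight R H A (antipode R (r.left k))) (fun k => inclRight R H A (r.right k))
    (fun Q _ β hβ x => casimir ht r β hβ x) x
  refine ⟨y, ?_⟩
  rw [← hy]
  simp only [← map_mul, ← map_sum]
  rw [sum_antipode_mul_eq_smul, map_smul, map_one, smul_mul_assoc, one_mul]

end Casimir

end SmashProduct

namespace SmashProduct

open Coalgebra HopfAlgebra

/-! ### Descent of semiprimeness along an equivariant embedding. -/

section Map

variable {R H A A' : Type*} [CommRing R] [Ring H] [HopfAlgebra R H]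
  [CommRing A] [Algebra R A] [CommRing A'] [Algebra R A']

/-- The `R`-linear map `A # H → A' # H` induced by an algebra map `A → A'`. -/
noncomputable def mapLeft (H : Type*) [Ring H] [HopfAlgebra R H] (φ : A →ₐ[R] A') :
    SmashProduct R A H →ₗ[R] SmashProduct R A' H :=
  φ.toLinearMap.rTensor H

theorem mapLeft_tmul (φ : A →ₐ[R] A') (a : A) (h : H) :
    mapLeft H φ (tmul a h) = tmul (φ a) h := rfl

theorem mapLeft_injective [Module.Flat R H] (φ : A →ₐ[R] A') (hφ : Function.Injective φ) :
    Function.Injective (mapLeft H φ) :=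
  Module.Flat.rTensor_preserves_injective_linearMap φ.toLinearMap hφ

variable [Module H A] [IsScalarTower R H A] [IsModuleAlgebra R H A]
  [Module H A'] [IsScalarTower R H A'] [IsModuleAlgebra R H A']

theorem mapLeft_mul (φ : A →ₐ[R] A') (hφ : ∀ (h : H) (a : A), φ (h • a) = h • φ a)
    (x y : SmashProduct R A H) : mapLeft H φ (x * y) = mapLeft H φ x * mapLeft H φ y := by
  induction x using induction_on with
  | zero => simp
  | add x₁ x₂ h₁ h₂ => simp only [add_mul, map_add, h₁, h₂]
  | tmul a h =>
    induction y using induction_on with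
    | zero => simp
    | add y₁ y₂ h₁ h₂ => simp only [mul_add, map_add, h₁, h₂]
    | tmul b g =>
      have r := Coalgebra.Repr.arbitrary R h
      simp only [mapLeft_tmul, tmul_mul_tmul R H _ r, map_sum, map_mul, hφ]

theorem commute_inclLeft_of_mem_hopfInvariants {v : A} (hv : v ∈ hopfInvariants R H A)
    (x : SmashProduct R A H) : inclLeft R H A v * x = x * inclLeft R H A v := by
  induction x using induction_on with
  | zero => simp
  | add x₁ x₂ h₁ h₂ => simp only [mul_add, add_mul, h₁, h₂]
  | tmul a h =>
    have r := Coalgebra.Repr.arbitrary R h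
    rw [← inclLeft_mul_inclRight, mul_assoc, inclRight_mul_inclLeft r, ← mul_assoc, ← map_mul,
      mul_comm v a, map_mul, mul_assoc]
    congr 1
    conv_lhs => rw [← sum_counit_smul r]
    simp only [hv _, map_sum, map_smul, Finset.mul_sum, mul_smul_comm, smul_mul_assoc]

/-- Flatness of `H` carries injectivity of multiplication by `ε(t)` from `A` to `A ⊗ H`. -/
theorem eq_zero_of_counit_smul_eq_zero [Module.Flat R H] {t : H}
    (hreg : algebraMap R A (counit t) ∈ nonZeroDivisors A) {x : SmashProduct R A H}
    (hx : counit (R := R) t • x = 0) : x = 0 := by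
  have hinj : Function.Injective (LinearMap.lsmul R A (counit (R := R) t)) := by
    rw [injective_iff_map_eq_zero]
    intro a ha
    rw [LinearMap.lsmul_apply, Algebra.smul_def] at ha
    exact (mul_left_mem_nonZeroDivisors_eq_zero_iff hreg).1 ha
  have hinj' := Module.Flat.rTensor_preserves_injective_linearMap (M := H) _ hinj
  have heq : (LinearMap.lsmul R A (counit (R := R) t)).rTensor H =
      counit (R := R) t • LinearMap.id := by
    ext a h
    simp [TensorProduct.smul_tmul']
  rw [heq] at hinj'
  exact (injective_iff_map_eq_zero (counit (R := R) t • LinearMap.id)).1 hinj' x hx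

/-- `A # H` is semiprime if `A` embeds in a von Neumann regular module algebra generated
over `A` by invariants. -/
theorem isSemiprimeRing_of_injective [Module.Flat R H] (φ : A →ₐ[R] A')
    (hφ : Function.Injective φ) (hequiv : ∀ (h : H) (a : A), φ (h • a) = h • φ a)
    (hA' : IsVonNeumannRegular A')
    (hspan : ∀ a' : A', a' ∈ AddSubgroup.closure
      {c | ∃ v ∈ hopfInvariants R H A', ∃ a, c = v * φ a})
    {t : H} (ht : IsRightIntegral R t)
    (hreg : algebraMap R A (counit t) ∈ nonZeroDivisors A) :
    IsSemiprimeRing (SmashProduct R A H) := by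
  intro I hI
  refine eq_bot_iff.2 fun x hx => ?_
  rw [TwoSidedIdeal.mem_bot]
  have hxs : ∀ s, x * s * x = 0 := fun s => hI _ (I.mul_mem_right _ _ hx) _ hx
  have hxa : ∀ a' h, mapLeft H φ x * tmul a' h * mapLeft H φ x = 0 := by
    intro a' h
    induction hspan a' using AddSubgroup.closure_induction with
    | mem c hc =>
      obtain ⟨v, hv, a, rfl⟩ := hc
      have h₁ : (tmul (v * φ a) h : SmashProduct R A' H) =
          inclLeft R H A' v * mapLeft H φ (tmul a h) := by
        rw [inclLeft_apply, mapLeft_tmul, tmul_one_mul_tmul]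
      -- The invariant `v` is central, so it moves out in front of the image of `x (a # h) x = 0`.
      rw [h₁, ← mul_assoc, ← commute_inclLeft_of_mem_hopfInvariants hv, mul_assoc, mul_assoc,
        ← mapLeft_mul φ hequiv, ← mapLeft_mul φ hequiv, ← mul_assoc, hxs, map_zero, mul_zero]
    | zero =>
      have : (tmul (0 : A') h : SmashProduct R A' H) = 0 := TensorProduct.zero_tmul _ _
      rw [this, mul_zero, zero_mul]
    | add c d _ _ hc hd => rw [add_tmul, mul_add, add_mul, hc, hd, add_zero]
    | neg c _ hc =>
      have : (tmul (-c) h : SmashProduct R A' H) = -tmul c h := TensorProduct.neg_tmul _ _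
      rw [this, mul_neg, neg_mul, hc, neg_zero]
  have hxy : ∀ y, mapLeft H φ x * y * mapLeft H φ x = 0 := by
    intro y
    induction y using induction_on with
    | zero => simp
    | add y₁ y₂ h₁ h₂ => rw [mul_add, add_mul, h₁, h₂, add_zero]
    | tmul a' h => exact hxa a' h
  obtain ⟨y, hy⟩ := exists_counit_smul_eq_mul_mul hA' ht (mapLeft H φ x)
  -- The scalar `ε(t)` is cancelled in `A # H`, so it need not be regular on `A'`.
  rw [hxy, ← map_smul] at hy
  exact eq_zero_of_counit_smul_eq_zero hreg
    ((injective_iff_map_eq_zero _).1 (mapLeft_injective φ hφ) _ hy)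

end Map

end SmashProduct

/-! ### Localizing a module algebra at invariants. -/

section InvariantLocalization

open Coalgebra

variable {R H A : Type*} [CommRing R] [Ring H] [HopfAlgebra R H]
  [CommRing A] [Algebra R A] [Module H A] [IsScalarTower R H A] [IsModuleAlgebra R H A]

variable (R H A) in
/-- The action of `H` on `A` as a ring map to the endomorphisms over the invariants. -/
def invariantEnd : H →+* Module.End (hopfInvariants R H A) A where
  toFun h :=
    { toFun := fun a => h • a
      map_add' := smul_add h
      map_smul' := fun b a => smul_invariant_mul b h a }
  map_one' := by ext; simp
  map_mul' g h := by ext; simp [mul_smul]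
  map_zero' := by ext; simp
  map_add' g h := by ext; simp [add_smul]

/-- The localization of a module algebra at a multiplicative set of invariants. -/
def InvariantLocalization (M : Submonoid (hopfInvariants R H A)) : Type _ :=
  Localization (Algebra.algebraMapSubmonoid A M)

namespace InvariantLocalization

variable (M : Submonoid (hopfInvariants R H A))

noncomputable instance : CommRing (InvariantLocalization M) :=
  inferInstanceAs (CommRing (Localization (Algebra.algebraMapSubmonoid A M)))

noncomputable instance : Algebra A (InvariantLocalization M) :=
  inferInstanceAs (Algebra A (Localization (Algebra.algebraMapSubmonoid A M)))

noncomputable instance : Algebra R (InvariantLocalization M) :=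
  inferInstanceAs (Algebra R (Localization (Algebra.algebraMapSubmonoid A M)))

noncomputable instance : Algebra (hopfInvariants R H A) (InvariantLocalization M) :=
  inferInstanceAs (Algebra (hopfInvariants R H A)
    (Localization (Algebra.algebraMapSubmonoid A M)))

instance : IsScalarTower R A (InvariantLocalization M) :=
  inferInstanceAs (IsScalarTower R A (Localization (Algebra.algebraMapSubmonoid A M)))

instance : IsScalarTower (hopfInvariants R H A) A (InvariantLocalization M) :=
  inferInstanceAs (IsScalarTower (hopfInvariants R H A) A
    (Localization (Algebra.algebraMapSubmonoid A M)))

instance : IsScalarTower R (hopfInvariants R H A) (InvariantLocalization M) :=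
  inferInstanceAs (IsScalarTower R (hopfInvariants R H A)
    (Localization (Algebra.algebraMapSubmonoid A M)))

instance : IsLocalization (Algebra.algebraMapSubmonoid A M) (InvariantLocalization M) :=
  inferInstanceAs (IsLocalization (Algebra.algebraMapSubmonoid A M)
    (Localization (Algebra.algebraMapSubmonoid A M)))

instance [IsReduced A] : IsReduced (InvariantLocalization M) :=
  isReduced_localizationPreserves (Algebra.algebraMapSubmonoid A M) _ inferInstance

/-- The localization map, linear over the invariants. -/
noncomputable def of : A →ₗ[hopfInvariants R H A] InvariantLocalization M :=
  (IsScalarTower.toAlgHom (hopfInvariants R H A) A (InvariantLocalization M)).toLinearMap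

instance : IsLocalizedModule M (of M) :=
  inferInstanceAs (IsLocalizedModule M
    (IsScalarTower.toAlgHom (hopfInvariants R H A) A (InvariantLocalization M)).toLinearMap)

/-- The extension of the action of `H` to the localization. -/
noncomputable def actionHom :
    H →+* Module.End (hopfInvariants R H A) (InvariantLocalization M) where
  toFun h := IsLocalizedModule.map M (of M) (of M) (invariantEnd R H A h)
  map_one' := by
    rw [map_one]
    exact IsLocalizedModule.map_id M (of M)
  map_mul' g h := by
    rw [map_mul]
    exact IsLocalizedModule.map_comp' M (of M) (of M) (of M) _ _
  map_zero' := by rw [map_zero, map_zero]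
  map_add' g h := by rw [map_add, map_add]

noncomputable instance : Module H (InvariantLocalization M) :=
  Module.compHom _ (actionHom M)

theorem smul_algebraMap (h : H) (a : A) :
    h • algebraMap A (InvariantLocalization M) a = algebraMap A _ (h • a) :=
  IsLocalizedModule.map_apply M (of M) (of M) (invariantEnd R H A h) a

theorem smul_invariant_smul (h : H) (b : hopfInvariants R H A) (x : InvariantLocalization M) :
    h • b • x = b • h • x :=
  map_smul (actionHom M h) b x

variable {M} in
theorem exists_smul_eq (x : InvariantLocalization M) :
    ∃ (s : M) (a : A), (s : hopfInvariants R H A) • x = algebraMap A _ a := by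
  obtain ⟨⟨a, s⟩, h⟩ := IsLocalizedModule.surj M (of M) x
  exact ⟨s, a, h⟩

variable {M} in
theorem eq_of_smul_eq (s : M) {x y : InvariantLocalization M}
    (h : (s : hopfInvariants R H A) • x = (s : hopfInvariants R H A) • y) : x = y :=
  IsLocalizedModule.smul_injective (of M) s h

theorem algebraMap_eq_zero_iff (a : A) :
    algebraMap A (InvariantLocalization M) a = 0 ↔
      ∃ s : M, (s : hopfInvariants R H A) • a = 0 :=
  IsLocalizedModule.eq_zero_iff M (of M)

instance : IsScalarTower R H (InvariantLocalization M) where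
  smul_assoc c h x := by
    obtain ⟨s, a, hs⟩ := exists_smul_eq x
    apply eq_of_smul_eq s
    rw [← smul_invariant_smul, hs, smul_comm (s : hopfInvariants R H A) c, ← smul_invariant_smul,
      hs, smul_algebraMap, smul_algebraMap, smul_assoc, Algebra.smul_def c (h • a), map_mul,
      ← IsScalarTower.algebraMap_apply, ← Algebra.smul_def]

instance : IsModuleAlgebra R H (InvariantLocalization M) where
  smul_mul h x y := by
    have r := Coalgebra.Repr.arbitrary R h
    rw [← r.eq]
    simp only [map_sum, TensorProduct.map_tmul, LinearMap.mul'_apply, orbitMap,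
      LinearMap.restrictScalars_apply, LinearMap.toSpanSingleton_apply]
    -- Denominators are invariants: they commute with the action and can be cancelled, which reduces
    -- the identity to `A`.
    obtain ⟨s, a, hs⟩ := exists_smul_eq x
    obtain ⟨s', b, hs'⟩ := exists_smul_eq y
    apply eq_of_smul_eq (s * s')
    rw [Submonoid.coe_mul, ← smul_invariant_smul, ← smul_mul_smul_comm, hs, hs', ← map_mul,
      smul_algebraMap, IsModuleAlgebra.smul_mul_repr R H A r, Finset.smul_sum, map_sum]
    refine Finset.sum_congr rfl fun k _ => ?_
    rw [← smul_mul_smul_comm, ← smul_invariant_smul, ← smul_invariant_smul, hs, hs',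
      smul_algebraMap, smul_algebraMap, map_mul]
  smul_one h := by
    rw [← map_one (algebraMap A _), smul_algebraMap, IsModuleAlgebra.smul_one (R := R),
      ← IsScalarTower.algebraMap_apply]

theorem mem_hopfInvariants_of_smul_eq (s : M) (b : hopfInvariants R H A)
    {x : InvariantLocalization M}
    (h : (s : hopfInvariants R H A) • x = algebraMap (hopfInvariants R H A) _ b) :
    x ∈ hopfInvariants R H (InvariantLocalization M) := by
  intro g
  apply eq_of_smul_eq s
  rw [← smul_invariant_smul, smul_comm (s : hopfInvariants R H A), h,
    IsScalarTower.algebraMap_apply _ A, smul_algebraMap]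
  have : g • (algebraMap (hopfInvariants R H A) A b) = _ := b.2 g
  rw [this, Algebra.smul_def, map_mul, ← IsScalarTower.algebraMap_apply, ← Algebra.smul_def]
  rfl

end InvariantLocalization

end InvariantLocalization

/-! ### Regular extensions inside a reduced module algebra. -/

section StableSubalgebra

open Coalgebra

variable {R H P : Type*} [CommRing R] [Ring H] [HopfAlgebra R H]
  [CommRing P] [Algebra R P] [Module H P] [IsScalarTower R H P]

/-- The action of `H` on a stable subalgebra. -/
abbrev Subalgebra.stableModule (U : Subalgebra R P) (hU : ∀ (h : H), ∀ y ∈ U, h • y ∈ U) :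
    Module H U :=
  letI : SMul H U := ⟨fun h y => ⟨h • (y : P), hU h y y.2⟩⟩
  Function.Injective.module H U.val.toAddMonoidHom Subtype.val_injective fun _ _ => rfl

theorem Subalgebra.stable_isScalarTower (U : Subalgebra R P)
    (hU : ∀ (h : H), ∀ y ∈ U, h • y ∈ U) :
    letI := U.stableModule hU
    IsScalarTower R H U :=
  letI := U.stableModule hU
  ⟨fun c h y => Subtype.ext (smul_assoc c h (y : P))⟩

theorem Subalgebra.stable_isModuleAlgebra [IsModuleAlgebra R H P] (U : Subalgebra R P)
    (hU : ∀ (h : H), ∀ y ∈ U, h • y ∈ U) :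
    letI := U.stableModule hU
    haveI := U.stable_isScalarTower hU
    IsModuleAlgebra R H U :=
  letI := U.stableModule hU
  haveI := U.stable_isScalarTower hU
  { smul_mul := fun h a b => by
      have r := Coalgebra.Repr.arbitrary R h
      rw [← r.eq]
      simp only [map_sum, TensorProduct.map_tmul, LinearMap.mul'_apply, orbitMap,
        LinearMap.restrictScalars_apply, LinearMap.toSpanSingleton_apply]
      apply Subtype.ext
      rw [AddSubmonoidClass.coe_finsetSum]
      exact IsModuleAlgebra.smul_mul_repr R H P r a b
    smul_one := fun h => Subtype.ext (IsModuleAlgebra.smul_one (R := R) (A := P) h) }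

universe w

/-- `A'` is the `V`-span of `φ(A)` in `P`. It is stable because the image of `V` is invariant, and
regular because each of its elements `y` is integral over `V`, hence lies in `y² V[y]`. -/
theorem exists_regular_extension_of_hom {V A : Type*} {P : Type w} [CommRing V] [CommRing P]
    [Algebra R P] [Module H P] [IsScalarTower R H P] [IsModuleAlgebra R H P] [IsReduced P]
    [CommRing A] [Algebra R A] [Module H A] [IsScalarTower R H A]
    (hV : IsVonNeumannRegular V) (f : V →+* P) (hf : ∀ v, f v ∈ hopfInvariants R H P)
    (φ : A →ₐ[R] P) (hφ : Function.Injective φ) (hequiv : ∀ (h : H) (a : A), φ (h • a) = h • φ a)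
    (hint : ∀ a, f.IsIntegralElem (φ a)) :
    ∃ (A' : Type w) (_ : CommRing A') (_ : Algebra R A') (_ : Module H A')
      (_ : IsScalarTower R H A') (_ : IsModuleAlgebra R H A') (ψ : A →ₐ[R] A'),
      Function.Injective ψ ∧ (∀ (h : H) (a : A), ψ (h • a) = h • ψ a) ∧
      IsVonNeumannRegular A' ∧ ∀ a' : A', a' ∈ AddSubgroup.closure
        {c | ∃ v ∈ hopfInvariants R H A', ∃ a, c = v * ψ a} := by
  let _ : Algebra V P := f.toAlgebra
  let W : Subalgebra V P := Algebra.adjoin V (Set.range φ)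
  -- `φ(A)` is already closed under multiplication, so the generated `V`-algebra is just its span.
  have hW : ∀ y, y ∈ W ↔ y ∈ Submodule.span V (Set.range φ) := by
    intro y
    rw [← Subalgebra.mem_toSubmodule, Algebra.adjoin_eq_span]
    have : Submonoid.closure (Set.range φ) = MonoidHom.mrange (φ : A →* P) := by
      rw [← Submonoid.closure_eq (MonoidHom.mrange (φ : A →* P))]
      rfl
    rw [this]
    rfl
  have hφW : ∀ a, φ a ∈ W := fun a => Algebra.subset_adjoin ⟨a, rfl⟩
  let U : Subalgebra R P :=
    { W.toSubsemiring with
      algebraMap_mem' := fun c => by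
        have := hφW (algebraMap R A c)
        rwa [φ.commutes] at this }
  have hUW : ∀ y, y ∈ U ↔ y ∈ W := fun y => Iff.rfl
  have hU : ∀ (h : H), ∀ y ∈ U, h • y ∈ U := by
    intro h y hy
    rw [hUW, hW] at hy ⊢
    induction hy using Submodule.span_induction with
    | mem y hy =>
      obtain ⟨a, rfl⟩ := hy
      exact Submodule.subset_span ⟨h • a, hequiv h a⟩
    | zero => rw [smul_zero]; exact Submodule.zero_mem _
    | add x y _ _ hx hy => rw [smul_add]; exact Submodule.add_mem _ hx hy
    | smul v y _ hy =>
      have : h • v • y = v • h • y := smul_invariant_mul ⟨f v, hf v⟩ h y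
      rw [this]
      exact Submodule.smul_mem _ _ hy
  have hfU : ∀ v, f v ∈ U := fun v => W.algebraMap_mem v
  let _ := U.stableModule hU
  have := U.stable_isScalarTower hU
  have := U.stable_isModuleAlgebra hU
  refine ⟨U, inferInstance, inferInstance, inferInstance, inferInstance, inferInstance,
    φ.codRestrict U hφW, ?_, ?_, ?_, ?_⟩
  · exact fun a b hab => hφ (congrArg Subtype.val hab)
  · exact fun h a => Subtype.ext (hequiv h a)
  · intro y
    have hy : IsIntegral V (y : P) := by
      have : W ≤ integralClosure V P := Algebra.adjoin_le (by
        rintro _ ⟨a, rfl⟩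
        exact hint a)
      exact this y.2
    obtain ⟨q, hq⟩ := hV.exists_eq_sq_mul_aeval hy
    exact ⟨⟨Polynomial.aeval (y : P) q,
      (Algebra.adjoin_le (Set.singleton_subset_iff.2 y.2) : Algebra.adjoin V {(y : P)} ≤ W)
        (Polynomial.aeval_mem_adjoin_singleton V (y : P))⟩, Subtype.ext hq⟩
  · suffices key : ∀ y (hy : y ∈ Submodule.span V (Set.range φ)),
        (⟨y, (hW y).2 hy⟩ : U) ∈ AddSubgroup.closure
          {c | ∃ v ∈ hopfInvariants R H U, ∃ a, c = v * φ.codRestrict U hφW a} from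
      fun y => key y ((hW y).1 y.2)
    intro y hy
    induction hy using Submodule.span_induction with
    | mem y hy =>
      obtain ⟨a, rfl⟩ := hy
      refine AddSubgroup.subset_closure ⟨1, one_mem _, a, ?_⟩
      rw [one_mul]
      rfl
    | zero => exact AddSubgroup.zero_mem _
    | add x y hx hy hx' hy' =>
      exact AddSubgroup.add_mem _ hx' hy'
    | smul v y hy hy' =>
      let fv : U := ⟨f v, hfU v⟩
      have hfv : fv ∈ hopfInvariants R H U := fun h => Subtype.ext (hf v h)
      change fv * ⟨y, (hW y).2 hy⟩ ∈ _
      generalize (⟨y, (hW y).2 hy⟩ : U) = z at hy' ⊢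
      induction hy' using AddSubgroup.closure_induction with
      | mem c hc =>
        obtain ⟨v', hv', a, rfl⟩ := hc
        exact AddSubgroup.subset_closure ⟨fv * v', mul_mem hfv hv', a, by rw [mul_assoc]⟩
      | zero => rw [mul_zero]; exact AddSubgroup.zero_mem _
      | add c d _ _ hc hd => rw [mul_add]; exact AddSubgroup.add_mem _ hc hd
      | neg c _ hc => rw [mul_neg]; exact AddSubgroup.neg_mem _ hc

instance Pi.isModuleAlgebra {ι : Type*} (L : ι → Type*) [∀ i, CommRing (L i)]
    [∀ i, Algebra R (L i)] [∀ i, Module H (L i)] [∀ i, IsScalarTower R H (L i)]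
    [∀ i, IsModuleAlgebra R H (L i)] : IsModuleAlgebra R H (∀ i, L i) where
  smul_mul h a b := by
    have r := Coalgebra.Repr.arbitrary R h
    rw [← r.eq]
    simp only [map_sum, TensorProduct.map_tmul, LinearMap.mul'_apply, orbitMap,
      LinearMap.restrictScalars_apply, LinearMap.toSpanSingleton_apply]
    ext i
    rw [Finset.sum_apply]
    exact IsModuleAlgebra.smul_mul_repr R H (L i) r (a i) (b i)
  smul_one h := by
    ext i
    exact IsModuleAlgebra.smul_one (R := R) h

end StableSubalgebra

/-! ### Minimal primes of the invariants and the main theorem. -/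

theorem Localization.AtPrime.isUnit_or_eq_zero_of_mem_minimalPrimes {B : Type*} [CommRing B]
    [IsReduced B] (p : Ideal B) [p.IsPrime] (hp : p ∈ minimalPrimes B)
    (k : Localization.AtPrime p) : IsUnit k ∨ k = 0 := by
  by_contra! h
  have hk : k ∈ IsLocalRing.maximalIdeal (Localization.AtPrime p) := h.1
  have hrad := IsLocalization.AtPrime.radical_map_of_mem_minimalPrimes
    (A := Localization.AtPrime p) p ⊥ hp
  rw [Localization.AtPrime.map_eq_maximalIdeal, Ideal.map_bot] at hrad
  rw [← hrad] at hk
  have : IsReduced (Localization.AtPrime p) :=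
    isReduced_localizationPreserves p.primeCompl _ inferInstance
  obtain ⟨n, hn⟩ := hk
  exact h.2 (IsNilpotent.eq_zero ⟨n, hn⟩)

section Main

open Coalgebra HopfAlgebra

variable {R H A : Type*} [CommRing R] [Ring H] [HopfAlgebra R H]
  [CommRing A] [Algebra R A] [Module H A] [IsScalarTower R H A] [IsModuleAlgebra R H A]

/-- The elements killed by the annihilator of `a` form a stable ideal containing `a`, hence
containing an invariant `β ≠ 0`. Since the invariants are reduced, some minimal prime misses `β`; it
contains every `b` with `b β = 0`. -/
theorem exists_minimalPrime_of_ne_zero [IsReduced A]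
    [Algebra.IsIntegral (hopfInvariants R H A) A] {t : H} (ht : IsLeftIntegral R t)
    (hreg : algebraMap R A (counit t) ∈ nonZeroDivisors A) {a : A} (ha : a ≠ 0) :
    ∃ p ∈ minimalPrimes (hopfInvariants R H A),
      ∀ b : hopfInvariants R H A, b • a = 0 → b ∈ p := by
  let D : Ideal A :=
    { carrier := {d | ∀ b : hopfInvariants R H A, b • a = 0 → b • d = 0}
      add_mem' := fun hx hy b hb => by rw [smul_add, hx b hb, hy b hb, add_zero]
      zero_mem' := fun b _ => smul_zero b
      smul_mem' := fun c x hx b hb => by rw [smul_comm, hx b hb, smul_zero] }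
  obtain ⟨β, hβ, hβ0⟩ := exists_invariant_mem_of_stable ht hreg D
    (fun h x hx b hb => (smul_invariant_mul b h x).symm.trans
      ((congrArg (h • ·) (hx b hb)).trans (smul_zero h))) (fun b hb => hb) ha
  have hred : IsReduced (hopfInvariants R H A) :=
    isReduced_of_injective (hopfInvariants R H A).val Subtype.val_injective
  have : ∃ p ∈ minimalPrimes (hopfInvariants R H A), β ∉ p := by
    by_contra! hall
    refine hβ0 ?_
    have h1 : β ∈ sInf (minimalPrimes (hopfInvariants R H A)) := by
      rw [Ideal.mem_sInf]
      exact fun {p} hp => hall p hp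
    have h2 : β ∈ (⊥ : Ideal (hopfInvariants R H A)).radical := by
      rwa [← Ideal.sInf_minimalPrimes]
    obtain ⟨n, hn⟩ := h2
    exact IsNilpotent.eq_zero ⟨n, hn⟩
  obtain ⟨p, hp, hβp⟩ := this
  refine ⟨p, hp, fun b hb => ?_⟩
  have h0 : b * β = 0 := Subtype.ext (hβ b hb)
  exact (hp.1.1.mem_or_mem (h0 ▸ p.zero_mem : b * β ∈ p)).resolve_right hβp

universe w

theorem exists_regular_extension {A : Type w} [CommRing A] [Algebra R A] [Module H A]
    [IsScalarTower R H A] [IsModuleAlgebra R H A] [IsReduced A]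
    [Algebra.IsIntegral (hopfInvariants R H A) A] {t : H} (ht : IsLeftIntegral R t)
    (hreg : algebraMap R A (counit t) ∈ nonZeroDivisors A) :
    ∃ (A' : Type w) (_ : CommRing A') (_ : Algebra R A') (_ : Module H A')
      (_ : IsScalarTower R H A') (_ : IsModuleAlgebra R H A') (ψ : A →ₐ[R] A'),
      Function.Injective ψ ∧ (∀ (h : H) (a : A), ψ (h • a) = h • ψ a) ∧
      IsVonNeumannRegular A' ∧ ∀ a' : A', a' ∈ AddSubgroup.closure
        {c | ∃ v ∈ hopfInvariants R H A', ∃ a, c = v * ψ a} := by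
  let B := hopfInvariants R H A
  have hred : IsReduced B := isReduced_of_injective B.val Subtype.val_injective
  have hprime : ∀ p : minimalPrimes B, (p : Ideal B).IsPrime := fun p => p.2.1.1
  let L : minimalPrimes B → Type w := fun p => InvariantLocalization (p : Ideal B).primeCompl
  let K : minimalPrimes B → Type w := fun p => Localization.AtPrime (p : Ideal B)
  have hunit : ∀ (p : minimalPrimes B) (s : (p : Ideal B).primeCompl),
      IsUnit (algebraMap B (L p) s) := fun p s => by
    rw [IsScalarTower.algebraMap_apply B A (L p)]
    exact IsLocalization.map_units (L p)
      (⟨_, Algebra.mem_algebraMapSubmonoid_of_mem s⟩ :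
        Algebra.algebraMapSubmonoid A (p : Ideal B).primeCompl)
  let fp : ∀ p, K p →+* L p := fun p => IsLocalization.lift (hunit p)
  have hfp : ∀ p b, fp p (algebraMap B (K p) b) = algebraMap B (L p) b := fun p b =>
    IsLocalization.lift_eq (hunit p) b
  let f : (∀ p, K p) →+* ∀ p, L p := RingHom.pi fun p => (fp p).comp (Pi.evalRingHom K p)
  -- Each factor is a field, so a quasi-inverse is chosen componentwise.
  have hV : IsVonNeumannRegular (∀ p, K p) := by
    intro y
    have : ∀ p, ∃ q, y p = y p ^ 2 * q := fun p => by
      rcases Localization.AtPrime.isUnit_or_eq_zero_of_mem_minimalPrimes (p : Ideal B) p.2 (y p)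
        with h | h
      · obtain ⟨u, hu⟩ := h
        exact ⟨↑u⁻¹, by rw [← hu, pow_two, mul_assoc, Units.mul_inv, mul_one]⟩
      · exact ⟨0, by rw [h, mul_zero]⟩
    choose q hq using this
    exact ⟨q, funext hq⟩
  let φ : A →ₐ[R] ∀ p, L p := AlgHom.pi fun p => IsScalarTower.toAlgHom R A (L p)
  refine exists_regular_extension_of_hom hV f ?_ φ ?_ ?_ ?_
  · intro v h
    ext p
    refine (?_ : fp p (v p) ∈ hopfInvariants R H (L p)) h
    obtain ⟨⟨b, s⟩, hs⟩ := IsLocalization.surj (p : Ideal B).primeCompl (v p)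
    refine InvariantLocalization.mem_hopfInvariants_of_smul_eq _ s b ?_
    have := congrArg (fp p) hs
    rw [map_mul, hfp, hfp, mul_comm] at this
    rw [Algebra.smul_def]
    exact this
  · rw [injective_iff_map_eq_zero]
    intro a ha
    by_contra ha0
    -- At a minimal prime containing the annihilator of `a`, no denominator kills `a`.
    obtain ⟨p, hp, hann⟩ := exists_minimalPrime_of_ne_zero ht hreg ha0
    obtain ⟨s, hs⟩ := (InvariantLocalization.algebraMap_eq_zero_iff _ a).1
      (congrFun ha ⟨p, hp⟩)
    exact s.2 (hann _ hs)
  · intro h a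
    ext p
    exact (InvariantLocalization.smul_algebraMap _ h a).symm
  · intro a
    obtain ⟨q, hq, hqa⟩ := Algebra.IsIntegral.isIntegral (R := B) a
    refine RingHom.IsIntegralElem.of_comp (f := algebraMap B (∀ p, K p)) ?_
    have hcomp : f.comp (algebraMap B (∀ p, K p)) =
        (φ : A →+* ∀ p, L p).comp (algebraMap B A) := by
      ext b p
      exact (hfp p b).trans (IsScalarTower.algebraMap_apply B A (L p) b)
    rw [hcomp]
    exact RingHom.IsIntegralElem.map (f := algebraMap B A) ⟨q, hq, hqa⟩ (φ : A →+* ∀ p, L p)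

theorem IsSemiprimeRing.isReduced (hA : IsSemiprimeRing A) : IsReduced A := by
  refine (isReduced_iff_pow_one_lt 2 one_lt_two).2 fun a ha => ?_
  let I : TwoSidedIdeal A := (Ideal.span {a}).toTwoSided
  have hmem : ∀ x, x ∈ I ↔ ∃ c, x = c * a := fun x => by
    rw [Ideal.mem_toTwoSided, Ideal.mem_span_singleton']
    exact exists_congr fun c => eq_comm
  have hI := hA I fun x hx y hy => by
    obtain ⟨c, rfl⟩ := (hmem x).1 hx
    obtain ⟨d, rfl⟩ := (hmem y).1 hy
    linear_combination c * d * ha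
  have : a ∈ I := (hmem a).2 ⟨1, (one_mul a).symm⟩
  rwa [hI, TwoSidedIdeal.mem_bot] at this

end Main

theorem mainTheorem1 (R H A : Type*) [CommRing R] [Ring H] [HopfAlgebra R H]
    [CommRing A] [Algebra R A] [Module H A] [IsScalarTower R H A] [IsModuleAlgebra R H A]
    (hflat : Module.Flat R H)
    (hA : IsSemiprimeRing A)
    (hint : ∃ t : H, t ≠ 0 ∧ (IsLeftIntegral R t ∨ IsRightIntegral R t) ∧
      algebraMap R A (Coalgebra.counit t) ∈ nonZeroDivisors A)
    (hAH : Algebra.IsIntegral (hopfInvariants R H A) A) :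
    IsSemiprimeRing (SmashProduct R A H) := by
  have := hA.isReduced
  -- The left integral serves to find invariants, the right one to form the Casimir element. The
  -- antipode exchanges the two kinds and preserves the counit.
  obtain ⟨l, r, hl, hr, hlreg, hrreg⟩ : ∃ l r : H, IsLeftIntegral R l ∧ IsRightIntegral R r ∧
      algebraMap R A (Coalgebra.counit l) ∈ nonZeroDivisors A ∧
      algebraMap R A (Coalgebra.counit r) ∈ nonZeroDivisors A := by
    obtain ⟨t, -, ht | ht, hreg⟩ := hint
    · exact ⟨t, _, ht, ht.isRightIntegral_antipode, hreg,
        by rwa [HopfAlgebra.counit_antipode]⟩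
    · exact ⟨_, t, ht.isLeftIntegral_antipode, ht,
        by rwa [HopfAlgebra.counit_antipode], hreg⟩
  obtain ⟨A', _, _, _, _, _, φ, hφ, hequiv, hreg', hspan⟩ := exists_regular_extension hl hlreg
  exact SmashProduct.isSemiprimeRing_of_injective φ hφ hequiv hreg' hspan hr hrreg
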